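/- There are an integer $r$ and a function $f:\mathbb N\to\mathbb N$ such that the following holds. Let $L$ be a finite simplicial complex of dimension $d$ in which every vertex is contained in at most $R$ simplices. Suppose that the link of every $(d-1)$-simplex of $L$ consists of exactly two vertices, and that the link of every simplex of $L$ of positive dimension has even Euler characteristic (both hold, for instance, if $d\ge 1$ and $L$ is a combinatorial manifold, where every link is homeomorphic to a sphere). Let $L'$ be the barycentric subdivision of $L$: its vertices are (the barycenters of) the simplices of $L$, and its simplices are the nonempty chains $\sigma_0<\dots<\sigma_k$ of simplices of $L$. For a finite simplicial complex $K$ put one qubit on each vertex, with basis states $|0\rangle=|{\uparrow}\rangle$, $|1\rangle=|{\downarrow}\rangle$, and $|+\rangle=(|0\rangle+|1\rangle)/\sqrt2$. The GDS dual state on $K$ is $\prod_{k\ge 0}\prod_{\Delta^k\in K} C^kZ_{\Delta^k}\,|+\rangle^{\otimes K^{(0)}}$, where $C^kZ_\Delta$ is the diagonal gate equal to $-1$ if all $k+1$ qubits on the vertices of $\Delta$ are $\downarrow$ and to $+1$ otherwise. Let $G=\mathbb Z_2\times\mathbb Z_2^T$ act on qubits, $\mathbb Z_2$ by flipping all spins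 and $\mathbb Z_2^T$ (time reversal) by complex conjugation in the computational basis. Then there is a quantum circuit $C$ on the qubits at the vertices of $L'$ such that - every gate of $C$ commutes with the action of $G$; - the support of every gate of $C$ has diameter at most $r$ in the graph of vertices and edges of $L'$; - $C$ consists of at most $f(R)$ layers of gates with pairwise disjoint supports; - $C$ maps the GDS dual state on $L$, tensored with $|+\rangle$ on the barycenters of all simplices of $L$ of nonzero dimension, exactly to the GDS dual state on $L'$. -/

import Mathlib

namespace GDSDual

/-! ### Finite simplicial complexes -/

section Complexes

variable {V : Type*} [DecidableEq V]

/-- The largest dimension of a simplex of `L` is `d`. -/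
def HasDimension (L : AbstractSimplicialComplex V) (d : ℕ) : Prop :=
  (∀ s ∈ L.faces, s.card ≤ d + 1) ∧ ∃ s ∈ L.faces, s.card = d + 1

/-- The link of `s`: the simplices disjoint from `s` whose union with `s` is a simplex. -/
def link (L : AbstractSimplicialComplex V) (s : Finset V) : PreAbstractSimplicialComplex V where
  faces := {t | t ∈ L.faces ∧ Disjoint t s ∧ t ∪ s ∈ L.faces}
  isRelLowerSet_faces := by
    rintro t ⟨ht, hd, hu⟩
    refine ⟨(L.isRelLowerSet_faces ht).1, fun t' htt' hne => ?_⟩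
    refine ⟨(L.isRelLowerSet_faces ht).2 htt' hne, hd.mono_left htt', ?_⟩
    exact (L.isRelLowerSet_faces hu).2 (Finset.union_subset_union htt' (Finset.Subset.refl s))
      (hne.mono Finset.subset_union_left)

open Classical in
/-- The Euler characteristic of a finite complex, the sum of `(-1) ^ dim t` over its simplices
(all of them nonempty); it is `0` for the complex without simplices. -/
noncomputable def eulerChar [Fintype V] (K : PreAbstractSimplicialComplex V) : ℤ :=
  ∑ t : Finset V with t ∈ K.faces, (-1) ^ (t.card - 1)

/-- Every vertex lies in at most `R` simplices. -/
def VertexBound (L : AbstractSimplicialComplex V) (R : ℕ) : Prop :=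
  ∀ v : V, {s : Finset V | s ∈ L.faces ∧ v ∈ s}.ncard ≤ R

/-- The vertices of the barycentric subdivision of `L`: the barycenters of the simplices of `L`. -/
abbrev Barycenter (L : AbstractSimplicialComplex V) : Type _ := {s : Finset V // s ∈ L.faces}

noncomputable instance [Fintype V] (L : AbstractSimplicialComplex V) : Fintype (Barycenter L) :=
  Fintype.ofFinite {s : Finset V // s ∈ L.faces}

/-- The barycentric subdivision: its simplices are the nonempty finite chains
`σ₀ < σ₁ < ⋯ < σₖ` of simplices of `L`. -/
def barycentricSubdivision (L : AbstractSimplicialComplex V) :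
    AbstractSimplicialComplex (Barycenter L) where
  faces := {c | c.Nonempty ∧ IsChain (fun s t : Barycenter L => s.1 ⊆ t.1) (c : Set (Barycenter L))}
  isRelLowerSet_faces := by
    rintro c ⟨hne, hc⟩
    exact ⟨hne, fun c' hcc' hne' => ⟨hne', hc.mono (Finset.coe_subset.2 hcc')⟩⟩
  singleton_mem := fun s => ⟨Finset.singleton_nonempty s, by
    rw [Finset.coe_singleton]; exact Set.subsingleton_singleton.isChain⟩

/-- The graph of vertices and edges of a complex. -/
def oneSkeleton (L : AbstractSimplicialComplex V) : SimpleGraph V where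
  Adj u v := u ≠ v ∧ ({u, v} : Finset V) ∈ L.faces
  symm := ⟨fun u v h => ⟨h.1.symm, by rw [Finset.pair_comm]; exact h.2⟩⟩
  loopless := ⟨fun _ h => h.1 rfl⟩

/-- The barycenters of the simplices of nonzero dimension. -/
abbrev NewVertex (L : AbstractSimplicialComplex V) : Type _ :=
  {b : Barycenter L // 2 ≤ b.1.card}

/-- The vertices of the barycentric subdivision are the vertices of `L` and the barycenters of the
simplices of nonzero dimension. -/
noncomputable def vertexSplit (L : AbstractSimplicialComplex V) :
    V ⊕ NewVertex L ≃ Barycenter L :=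
  Equiv.ofBijective
    (Sum.elim (fun v => (⟨{v}, L.singleton_mem v⟩ : Barycenter L)) (fun b => b.1)) <| by
    constructor
    · rintro (v | ⟨⟨s, hs⟩, hb⟩) (w | ⟨⟨t, ht⟩, hb'⟩) h
      · have := congrArg Subtype.val h
        simpa using this
      · have := congrArg Subtype.val h
        simp only [Sum.elim_inl, Sum.elim_inr] at this
        simp only [← this, Finset.card_singleton] at hb'
        omega
      · have := congrArg Subtype.val h
        simp only [Sum.elim_inl, Sum.elim_inr] at this
        simp only [this, Finset.card_singleton] at hb
        omega
      · exact congrArg Sum.inr (Subtype.ext h)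
    · rintro ⟨s, hs⟩
      by_cases h : 2 ≤ s.card
      · exact ⟨Sum.inr ⟨⟨s, hs⟩, h⟩, rfl⟩
      · have h0 : 0 < s.card := Finset.card_pos.2 (L.isRelLowerSet_faces hs).1
        obtain ⟨v, rfl⟩ := Finset.card_eq_one.1 (show s.card = 1 by omega)
        exact ⟨Sum.inl v, rfl⟩

end Complexes

/-! ### Qubits, states, symmetric circuits -/

section Qubits

/-- Computational basis configurations of qubits at the sites `Q`; `0` is `↑` and `1` is `↓`. -/
abbrev Config (Q : Type*) := Q → ZMod 2

/-- Vectors of the Hilbert space `(ℂ²)^{⊗ Q}`, given by their amplitudes. -/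
abbrev State (Q : Type*) := Config Q → ℂ

/-- Operators on `(ℂ²)^{⊗ Q}`. -/
abbrev Op (Q : Type*) := Matrix (Config Q) (Config Q) ℂ

/-- The one-qubit state `(|0⟩ + |1⟩) / √2`. -/
noncomputable def ketPlus : ZMod 2 → ℂ := fun _ => ((√2 : ℝ) : ℂ)⁻¹

/-- The product state with all qubits in `|+⟩`. -/
noncomputable def plusState (Q : Type*) [Fintype Q] : State Q := fun x => ∏ q, ketPlus (x q)

/-- The tensor product of a state on the sites `A` and a state on the sites `B`, where the sites
`C` are split into `A` and `B` by `e`. -/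
def tensorState {A B C : Type*} (e : A ⊕ B ≃ C) (ψ : State A) (φ : State B) : State C :=
  fun x => ψ (fun a => x (e (Sum.inl a))) * φ (fun b => x (e (Sum.inr b)))

/-- The action of `(a, t) ∈ ℤ₂ × ℤ₂ᵀ`: the internal generator flips all spins, the time reversal
generator is complex conjugation in the computational basis (an antilinear map). -/
def symmetryAction {Q : Type*} (g : ZMod 2 × ZMod 2) (ψ : State Q) : State Q :=
  fun x => if g.2 = 0 then ψ (fun q => x q - g.1) else starRingEnd ℂ (ψ (fun q => x q - g.1))

variable {Q : Type*} [Fintype Q] [DecidableEq Q]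

/-- `U = u ⊗ 1` for some operator `u` on the qubits in `S`. -/
def SupportedOn (S : Finset Q) (U : Op Q) : Prop :=
  ∃ u : Op S, ∀ x y : Config Q,
    U x y = if ∀ q, q ∉ S → x q = y q then u (fun q => x q) (fun q => y q) else 0

/-- A quantum gate: a unitary acting on the qubits in `support`. -/
structure Gate (Q : Type*) [Fintype Q] [DecidableEq Q] where
  support : Finset Q
  op : Op Q
  unitary : op ∈ Matrix.unitaryGroup (Config Q) ℂ
  supported : SupportedOn support op

/-- The gate commutes with the action of `ℤ₂ × ℤ₂ᵀ`. -/
def Gate.IsSymmetric (g : Gate Q) : Prop :=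
  ∀ (h : ZMod 2 × ZMod 2) (ψ : State Q),
    g.op.mulVec (symmetryAction h ψ) = symmetryAction h (g.op.mulVec ψ)

/-- A quantum circuit: a list of layers, each a list of gates with pairwise disjoint supports. -/
structure Circuit (Q : Type*) [Fintype Q] [DecidableEq Q] where
  layers : List (List (Gate Q))
  disjoint : ∀ l ∈ layers, l.Pairwise fun g h => Disjoint g.support h.support

/-- The number of layers. -/
def Circuit.depth (c : Circuit Q) : ℕ := c.layers.length

/-- The action on states, layer after layer. -/
def Circuit.apply (c : Circuit Q) (ψ : State Q) : State Q :=
  c.layers.foldl (fun φ l => l.foldl (fun χ g => g.op.mulVec χ) φ) ψ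

/-- Every gate is `ℤ₂ × ℤ₂ᵀ`-symmetric. -/
def Circuit.IsLocallySymmetric (c : Circuit Q) : Prop :=
  ∀ l ∈ c.layers, ∀ g ∈ l, g.IsSymmetric

/-- The qubits sit on the vertices of `K`, and any two qubits in the support of a gate are at
distance at most `r` in the graph of vertices and edges of `K`. -/
def Circuit.HasRange (c : Circuit Q) (K : AbstractSimplicialComplex Q) (r : ℕ) : Prop :=
  ∀ l ∈ c.layers, ∀ g ∈ l, ∀ p ∈ g.support, ∀ q ∈ g.support, (oneSkeleton K).edist p q ≤ r

/-- The gate `CᵏZ` on the `k + 1` qubits in `s`: the sign is `-1` if they are all `↓`. -/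
def ckZ (s : Finset Q) : Op Q := Matrix.diagonal fun x => if ∀ q ∈ s, x q = 1 then -1 else 1

open Classical in
/-- The disentangler of a complex: the product of `CᵏZ` over all its `k`-simplices, for all `k`
(the gates are diagonal, so the product is taken entry by entry). -/
noncomputable def disentangler (K : AbstractSimplicialComplex Q) : Op Q :=
  Matrix.diagonal fun x => ∏ s : Finset Q with s ∈ K.faces, ckZ s x x

/-- The GDS dual state on a complex, with one qubit at each vertex. -/
noncomputable def gdsDualState (K : AbstractSimplicialComplex Q) : State Q :=
  (disentangler K).mulVec (plusState Q)

end Qubits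

end GDSDual

/-! Both states are the all-plus state with signs: the exponents are N', the number of all-down
simplices of L' modulo two, and N, the same number for L. The diagonal sign with exponent N' - N
thus maps one state to the other. The issue is to factor it into local signs that are each invariant
under the global flip.

Replace the spins at the barycenters one at a time by the spin at a chosen vertex of the simplex.
After all replacements N' has become N (`downCount_someVertex`), so N' - N telescopes into single
steps. A step changes one spin, so only the simplices of L' around it matter and the step is local
(`interpolationStep_congr`).

For flip invariance, let B_s count modulo two the all-down chains strictly below s, the empty one
included. Sorting chains by their top gives B_s = 1 + ∑_{t<s} y_t B_t. A simplex has an even number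
of proper nonempty faces, and intervals between nested simplices are even too, so every B_s is
flip-invariant (`chainSumBelow_add_one`). The flip therefore changes N' = ∑ y_t B_t by ∑ B_t, which
the recursion turns into a constant plus ∑_r #{t > r} y_r B_r. Modulo two #{t > r} is the Euler
characteristic of the link of r, which vanishes if r has positive dimension; if r is a vertex, B_r =
1. So the change of N' under a flip depends only on the spins at vertices of L. The replacements
leave these alone, hence each step is flip-invariant (`interpolationStep_add_one`).

Real diagonal gates commute with time reversal and with each other, so a greedy colouring of their
boundedly overlapping supports yields the layers. -/

namespace GDSDual

set_option linter.unusedSectionVars false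

/-! ### Chain sums in finite posets -/

section ChainSums

variable {α : Type*} [PartialOrder α] [DecidableEq α]

open Classical in
/-- The sum over all chains in `S`, the empty chain included, of the products of the values
of `y`. -/
noncomputable def chainSum (y : α → ZMod 2) (S : Finset α) : ZMod 2 :=
  ∑ c ∈ S.powerset.filter (fun c : Finset α => IsChain (· ≤ ·) (c : Set α)), ∏ a ∈ c, y a

open Classical in
/-- A nonempty chain consists of its largest element and a chain below it. -/
theorem chainSum_eq (y : α → ZMod 2) (S : Finset α) :
    chainSum y S = 1 + ∑ t ∈ S, y t * chainSum y (S.filter (· < t)) := by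
  have h0 : (∅ : Finset α) ∈
      S.powerset.filter (fun c : Finset α => IsChain (· ≤ ·) (c : Set α)) := by
    simp
  rw [chainSum, ← Finset.add_sum_erase _ _ h0, Finset.prod_empty]
  congr 1
  simp only [chainSum, Finset.mul_sum]
  rw [Finset.sum_sigma']
  symm
  refine Finset.sum_bij (fun p _ => insert p.1 p.2) ?_ ?_ ?_ ?_
  · rintro ⟨t, c⟩ h
    simp only [Finset.mem_sigma, Finset.mem_filter, Finset.mem_powerset, Finset.mem_erase] at h ⊢
    obtain ⟨ht, hc, hch⟩ := h
    refine ⟨Finset.insert_ne_empty _ _, ?_, ?_⟩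
    · exact Finset.insert_subset ht (hc.trans (Finset.filter_subset _ _))
    · rw [Finset.coe_insert]
      exact hch.insert fun b hb _ => Or.inr (Finset.mem_filter.1 (hc hb)).2.le
  · rintro ⟨t, c⟩ h ⟨t', c'⟩ h' heq
    simp only [Finset.mem_sigma, Finset.mem_filter, Finset.mem_powerset] at h h' heq
    have hlt : ∀ a ∈ c, a < t := fun a ha => (Finset.mem_filter.1 (h.2.1 ha)).2
    have hlt' : ∀ a ∈ c', a < t' := fun a ha => (Finset.mem_filter.1 (h'.2.1 ha)).2
    have htt : t = t' := by
      have h1 : t ∈ insert t' c' := heq ▸ Finset.mem_insert_self t c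
      have h2 : t' ∈ insert t c := heq ▸ Finset.mem_insert_self t' c'
      rcases Finset.mem_insert.1 h1 with h1 | h1
      · exact h1
      · rcases Finset.mem_insert.1 h2 with h2 | h2
        · exact h2.symm
        · exact absurd ((hlt' _ h1).trans (hlt _ h2)) (lt_irrefl _)
    subst htt
    have hc : c = c' := by
      rw [← Finset.erase_insert (fun hm => lt_irrefl _ (hlt _ hm)), heq,
        Finset.erase_insert (fun hm => lt_irrefl _ (hlt' _ hm))]
    rw [hc]
  · intro c hc
    simp only [Finset.mem_filter, Finset.mem_powerset, Finset.mem_erase] at hc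
    obtain ⟨hne, hcS, hch⟩ := hc
    obtain ⟨t, ht⟩ := c.exists_maximal (Finset.nonempty_iff_ne_empty.2 hne)
    refine ⟨⟨t, c.erase t⟩, ?_, Finset.insert_erase ht.1⟩
    simp only [Finset.mem_sigma, Finset.mem_filter, Finset.mem_powerset]
    refine ⟨hcS ht.1, fun a ha => ?_, hch.mono (Finset.coe_subset.2 (Finset.erase_subset _ _))⟩
    have hac := Finset.mem_of_mem_erase ha
    have hne := Finset.ne_of_mem_erase ha
    refine Finset.mem_filter.2 ⟨hcS hac, lt_of_le_of_ne ?_ hne⟩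
    rcases hch hac ht.1 hne with h | h
    · exact h
    · exact ht.2 hac h
  · rintro ⟨t, c⟩ h
    simp only [Finset.mem_sigma, Finset.mem_filter, Finset.mem_powerset] at h
    rw [Finset.prod_insert (fun hm => lt_irrefl _ (Finset.mem_filter.1 (h.2.1 hm)).2)]

variable [Fintype α]

open Classical in
/-- The sum over the chains of elements below `t`. -/
noncomputable def chainSumBelow (y : α → ZMod 2) (t : α) : ZMod 2 :=
  chainSum y (Finset.univ.filter (· < t))

theorem chainSumBelow_eq (y : α → ZMod 2) (s : α) [DecidablePred (· < s)] :
    chainSumBelow y s = 1 + ∑ t with t < s, y t * chainSumBelow y t := by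
  classical
  rw [chainSumBelow, chainSum_eq]
  congr 1
  refine Finset.sum_congr (Finset.filter_congr_decidable _ _ _) fun t ht => ?_
  have hts : t < s := (Finset.mem_filter.1 ht).2
  rw [chainSumBelow]
  congr 2
  ext a
  simp only [Finset.mem_filter, Finset.mem_univ, true_and]
  exact ⟨fun h => h.2, fun h => ⟨h.trans hts, h⟩⟩

theorem chainSum_univ_eq (y : α → ZMod 2) :
    chainSum y Finset.univ = 1 + ∑ t, y t * chainSumBelow y t := by
  classical
  rw [chainSum_eq]
  rfl

open Classical in
/-- If lower sets and open intervals have even size, then flipping all values does not change the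
sum over the chains below a given element. -/
theorem chainSumBelow_add_one
    (hlow : ∀ s : α, Even (Finset.univ.filter (· < s)).card)
    (hint : ∀ r s : α, r < s → Even (Finset.univ.filter (fun t => r < t ∧ t < s)).card)
    (y : α → ZMod 2) (s : α) :
    chainSumBelow (fun a => y a + 1) s = chainSumBelow y s := by
  induction s using WellFoundedLT.induction with
  | ind s ih =>
    -- This is the error term of the flip. The recursion expands it into the number of t below s,
    -- plus a term for each r weighted by the number of t between r and s; all these numbers are
    -- even.
    have hsum : ∑ t with t < s, chainSumBelow y t = 0 := by
      rw [Finset.sum_congr rfl fun t _ => chainSumBelow_eq y t, Finset.sum_add_distrib,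
        Finset.sum_const, nsmul_one,
        (ZMod.natCast_eq_zero_iff_even).2 (hlow s), zero_add]
      rw [Finset.sum_comm' (t' := Finset.univ.filter (· < s))
        (s' := fun r => Finset.univ.filter (fun t => r < t ∧ t < s))]
      · refine Finset.sum_eq_zero fun r hr => ?_
        rw [Finset.sum_const, nsmul_eq_mul,
          (ZMod.natCast_eq_zero_iff_even).2 (hint r s (Finset.mem_filter.1 hr).2), zero_mul]
      · intro t r
        simp only [Finset.mem_filter, Finset.mem_univ, true_and]
        exact ⟨fun h => ⟨⟨h.2, h.1⟩, h.2.trans h.1⟩, fun h => ⟨h.1.2, h.1.1⟩⟩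
    rw [chainSumBelow_eq, chainSumBelow_eq y s]
    congr 1
    calc ∑ t with t < s, (y t + 1) * chainSumBelow (fun a => y a + 1) t
        = ∑ t with t < s, (y t * chainSumBelow y t + chainSumBelow y t) := by
          refine Finset.sum_congr rfl fun t ht => ?_
          rw [ih t (Finset.mem_filter.1 ht).2, add_one_mul]
      _ = _ := by rw [Finset.sum_add_distrib, hsum, add_zero]

-- The sums below each t do not see the flip, so the difference is the sum of all of them. One more
-- use of the recursion, with the order of summation exchanged, weights each r by the number of
-- elements above it.
open Classical in
theorem chainSum_univ_add_one
    (hlow : ∀ s : α, Even (Finset.univ.filter (· < s)).card)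
    (hint : ∀ r s : α, r < s → Even (Finset.univ.filter (fun t => r < t ∧ t < s)).card)
    (y : α → ZMod 2) :
    chainSum (fun a => y a + 1) Finset.univ - chainSum y Finset.univ =
      Fintype.card α +
        ∑ r, (Finset.univ.filter (r < ·)).card * (y r * chainSumBelow y r) := by
  rw [chainSum_univ_eq, chainSum_univ_eq]
  simp only [chainSumBelow_add_one hlow hint y, add_one_mul, Finset.sum_add_distrib]
  have h : ∑ t, chainSumBelow y t = Fintype.card α +
        ∑ r, (Finset.univ.filter (r < ·)).card * (y r * chainSumBelow y r) := by
    rw [Finset.sum_congr rfl fun t _ => chainSumBelow_eq y t, Finset.sum_add_distrib,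
        Finset.sum_const, nsmul_one, Finset.card_univ]
    congr 1
    rw [Finset.sum_comm' (t' := Finset.univ) (s' := fun r => Finset.univ.filter (r < ·))]
    · simp only [Finset.sum_const, nsmul_eq_mul]
    · simp
  rw [h]
  ring

end ChainSums

/-! ### The number of down simplices modulo two -/

section DownCount

open Classical in
/-- The number of simplices of `K` all of whose vertices are down, modulo two. -/
noncomputable def downCount {Q : Type*} [Fintype Q] (K : AbstractSimplicialComplex Q)
    (x : Config Q) : ZMod 2 :=
  ∑ s : Finset Q with s ∈ K.faces, ∏ q ∈ s, x q

open Classical in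
/-- The effect of changing a configuration at the single vertex `q` depends only on the star
of `q`. -/
theorem downCount_sub_congr {Q : Type*} [Fintype Q] (K : AbstractSimplicialComplex Q) (q : Q)
    {x y x' y' : Config Q} (hxy : ∀ p, p ≠ q → x p = y p) (hxy' : ∀ p, p ≠ q → x' p = y' p)
    (hx : ∀ s ∈ K.faces, q ∈ s → ∀ p ∈ s, x p = x' p)
    (hy : ∀ s ∈ K.faces, q ∈ s → ∀ p ∈ s, y p = y' p) :
    downCount K x - downCount K y = downCount K x' - downCount K y' := by
  simp only [downCount, ← Finset.sum_sub_distrib]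
  refine Finset.sum_congr rfl fun s hs => ?_
  have hs := (Finset.mem_filter.1 hs).2
  by_cases hq : q ∈ s
  · rw [Finset.prod_congr rfl (hx s hs hq), Finset.prod_congr rfl (hy s hs hq)]
  · have hne : ∀ p ∈ s, p ≠ q := fun p hp h => hq (h ▸ hp)
    rw [Finset.prod_congr rfl fun p hp => hxy p (hne p hp),
      Finset.prod_congr rfl fun p hp => hxy' p (hne p hp), sub_self, sub_self]

/-! ### Chains of simplices: parity of intervals and links, and pull-back along chosen vertices. -/

variable {V : Type*} [Fintype V] [DecidableEq V] (L : AbstractSimplicialComplex V)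

theorem downCount_barycentricSubdivision (y : Config (Barycenter L)) :
    downCount (barycentricSubdivision L) y = ∑ t, y t * chainSumBelow y t := by
  classical
  rw [← add_right_inj (1 : ZMod 2), ← chainSum_univ_eq, chainSum]
  have h0 : (∅ : Finset (Barycenter L)) ∈ Finset.univ.powerset.filter
      (fun c : Finset (Barycenter L) => IsChain (· ≤ ·) (c : Set (Barycenter L))) := by
    simp
  rw [← Finset.add_sum_erase _ _ h0, Finset.prod_empty, downCount]
  congr 1
  refine Finset.sum_congr ?_ fun _ _ => rfl
  ext c
  simp only [Finset.mem_filter, Finset.mem_erase, Finset.mem_powerset, Finset.subset_univ,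
    Finset.mem_univ, true_and, ← Finset.nonempty_iff_ne_empty]
  rfl

/-- The barycenters strictly below `s` and strictly above `r` are the sets strictly between. -/
theorem sum_barycenter_between {M : Type*} [AddCommMonoid M] (r : Finset V) (s : Barycenter L)
    (f : Finset V → M) [DecidablePred fun t : Barycenter L => r ⊂ t.1 ∧ t < s] :
    ∑ t : Barycenter L with r ⊂ t.1 ∧ t < s, f t.1 = ∑ t ∈ Finset.Ioo r s.1, f t := by
  refine Finset.sum_bij (fun t _ => t.1) ?_ ?_ ?_ fun _ _ => rfl
  · intro t ht
    exact Finset.mem_Ioo.2 (Finset.mem_filter.1 ht).2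
  · intro t _ t' _ h
    exact Subtype.ext h
  · intro t ht
    have ht := Finset.mem_Ioo.1 ht
    have hne : t.Nonempty := Finset.nonempty_iff_ne_empty.2 fun h => by
      rw [h] at ht
      exact Finset.not_ssubset_empty _ ht.1
    exact ⟨⟨t, (L.isRelLowerSet_faces s.2).2 ht.2.le hne⟩,
      Finset.mem_filter.2 ⟨Finset.mem_univ _, ht⟩, rfl⟩

theorem empty_ssubset_barycenter (s : Barycenter L) : ∅ ⊂ s.1 :=
  Finset.empty_ssubset.2 (L.isRelLowerSet_faces s.2).1

theorem sum_barycenter_lt {M : Type*} [AddCommMonoid M] (s : Barycenter L)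
    (f : Finset V → M) [DecidablePred fun t : Barycenter L => t < s] :
    ∑ t : Barycenter L with t < s, f t.1 = ∑ t ∈ Finset.Ioo ∅ s.1, f t := by
  classical
  rw [← sum_barycenter_between]
  refine Finset.sum_congr (Finset.filter_congr fun t _ => ?_) fun _ _ => rfl
  exact ⟨fun h => ⟨empty_ssubset_barycenter L t, h⟩, fun h => h.2⟩

/-- The open interval has 2 ^ n - 2 elements with n ≥ 1, the two ends being removed from a Boolean
lattice. -/
theorem even_card_finset_Ioo {r s : Finset V} (h : r ⊂ s) : Even (Finset.Ioo r s).card := by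
  rw [Finset.card_Ioo_finset h.1]
  have hc := Finset.card_lt_card h
  obtain ⟨k, hk⟩ := Nat.exists_eq_add_of_lt hc
  rw [hk, show r.card + k + 1 - r.card = k + 1 by omega, pow_succ]
  exact ⟨2 ^ k - 1, by omega⟩

open Classical in
theorem even_card_barycenter_lt (s : Barycenter L) :
    Even (Finset.univ.filter (· < s)).card := by
  rw [Finset.card_eq_sum_ones, sum_barycenter_lt L s (fun _ => 1), ← Finset.card_eq_sum_ones]
  exact even_card_finset_Ioo (empty_ssubset_barycenter L s)

open Classical in
theorem even_card_barycenter_between (r s : Barycenter L) (h : r < s) :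
    Even (Finset.univ.filter (fun t => r < t ∧ t < s)).card := by
  have := sum_barycenter_between L r.1 s (fun _ => 1)
  rw [Finset.card_eq_sum_ones]
  refine (congrArg Even ?_).mp (even_card_finset_Ioo h)
  rw [Finset.card_eq_sum_ones, ← this]
  rfl

open Classical in
/-- The simplices that properly contain `s` correspond to the simplices of the link. -/
theorem card_barycenter_gt (s : Barycenter L) :
    (Finset.univ.filter (s < ·)).card =
      (Finset.univ.filter (fun t : Finset V => t ∈ (link L s.1).faces)).card := by
  refine Finset.card_bij (fun t _ => t.1 \ s.1) ?_ ?_ ?_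
  · intro t ht
    have ht : s.1 ⊂ t.1 := (Finset.mem_filter.1 ht).2
    refine Finset.mem_filter.2 ⟨Finset.mem_univ _, ?_, Finset.sdiff_disjoint, ?_⟩
    · exact (L.isRelLowerSet_faces t.2).2 Finset.sdiff_subset
        (Finset.sdiff_nonempty.2 ht.2)
    · rw [Finset.sdiff_union_of_subset ht.1]
      exact t.2
  · intro t ht t' ht' h
    have ht : s.1 ⊂ t.1 := (Finset.mem_filter.1 ht).2
    have ht' : s.1 ⊂ t'.1 := (Finset.mem_filter.1 ht').2
    apply Subtype.ext
    rw [← Finset.sdiff_union_of_subset ht.1, h, Finset.sdiff_union_of_subset ht'.1]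
  · intro t ht
    obtain ⟨h1, h2, h3⟩ := (Finset.mem_filter.1 ht).2
    refine ⟨⟨t ∪ s.1, h3⟩, Finset.mem_filter.2 ⟨Finset.mem_univ _, ?_⟩,
      Finset.union_sdiff_cancel_right h2⟩
    refine Finset.ssubset_iff_subset_ne.2 ⟨Finset.subset_union_right, fun h => ?_⟩
    have hts : t ⊆ s.1 := by
      rw [h]
      exact Finset.subset_union_left
    obtain ⟨a, ha⟩ := (L.isRelLowerSet_faces h1).1
    exact Finset.disjoint_left.1 h2 ha (hts ha)

-- Signs disappear modulo two, so the Euler characteristic becomes a plain count of simplices.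
open Classical in
theorem eulerChar_cast (K : PreAbstractSimplicialComplex V) :
    ((eulerChar K : ℤ) : ZMod 2) =
      (Finset.univ.filter (fun t : Finset V => t ∈ K.faces)).card := by
  rw [eulerChar, Int.cast_sum, Finset.sum_congr rfl (g := fun _ => (1 : ZMod 2)), Finset.sum_const,
    nsmul_one]
  intro t _
  rw [Int.cast_pow, Int.cast_neg, Int.cast_one, show (-1 : ZMod 2) = 1 by decide, one_pow]

open Classical in
theorem card_barycenter_gt_eq_zero
    (hL : ∀ s ∈ L.faces, 2 ≤ s.card → Even (eulerChar (link L s)))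
    (s : Barycenter L) (hs : 2 ≤ s.1.card) :
    ((Finset.univ.filter (s < ·)).card : ZMod 2) = 0 := by
  rw [card_barycenter_gt, ← eulerChar_cast]
  exact (ZMod.intCast_eq_zero_iff_even).2 (hL s.1 s.2 hs)

/-- Under a global flip the number of down simplices of the subdivision changes by an amount
determined by the spins on the vertices of `L`. -/
theorem downCount_add_one_sub_congr
    (hL : ∀ s ∈ L.faces, 2 ≤ s.card → Even (eulerChar (link L s)))
    {x y : Config (Barycenter L)} (h : ∀ s : Barycenter L, s.1.card = 1 → x s = y s) :
    downCount (barycentricSubdivision L) (fun s => x s + 1) -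
        downCount (barycentricSubdivision L) x =
      downCount (barycentricSubdivision L) (fun s => y s + 1) -
        downCount (barycentricSubdivision L) y := by
  classical
  have key : ∀ z : Config (Barycenter L),
      downCount (barycentricSubdivision L) (fun s => z s + 1) -
        downCount (barycentricSubdivision L) z =
      Fintype.card (Barycenter L) + ∑ r : Barycenter L,
        (Finset.univ.filter (r < ·)).card * (z r * chainSumBelow z r) := by
    intro z
    have h := chainSum_univ_add_one (α := Barycenter L)
      (fun s => by convert even_card_barycenter_lt L s)
      (fun r s hrs => by convert even_card_barycenter_between L r s hrs) z
    rw [chainSum_univ_eq, chainSum_univ_eq, add_sub_add_left_eq_sub,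
      ← downCount_barycentricSubdivision, ← downCount_barycentricSubdivision] at h
    rw [h]
    congr!
  rw [key, key]
  congr 1
  refine Finset.sum_congr rfl fun r _ => ?_
  by_cases hr : 2 ≤ r.1.card
  · rw [card_barycenter_gt_eq_zero L hL r hr, zero_mul, zero_mul]
  · have h0 : 0 < r.1.card := Finset.card_pos.2 (L.isRelLowerSet_faces r.2).1
    have h1 : r.1.card = 1 := by omega
    -- Nothing lies below a vertex, so only the empty chain contributes.
    have hb : ∀ z : Config (Barycenter L), chainSumBelow z r = 1 := by
      intro z
      rw [chainSumBelow_eq, Finset.filter_eq_empty_iff.2, Finset.sum_empty, add_zero]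
      intro t _ ht
      have ht : t.1.card < r.1.card := Finset.card_lt_card ht
      have : 0 < t.1.card := Finset.card_pos.2 (L.isRelLowerSet_faces t.2).1
      omega
    rw [hb, hb, h r h1]

/-- The barycenter of a vertex of `L`. -/
def vertexBarycenter (v : V) : Barycenter L := ⟨{v}, L.singleton_mem v⟩

/-- Some vertex of a simplex, as a vertex of the subdivision. -/
noncomputable def someVertex (s : Barycenter L) : Barycenter L :=
  vertexBarycenter L (L.isRelLowerSet_faces s.2).1.choose

theorem someVertex_le (s : Barycenter L) : someVertex L s ≤ s :=
  Finset.singleton_subset_iff.2 (L.isRelLowerSet_faces s.2).1.choose_spec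

theorem someVertex_of_card_eq_one {s : Barycenter L} (hs : s.1.card = 1) : someVertex L s = s :=
  Subtype.ext (Finset.eq_of_subset_of_card_le (someVertex_le L s)
    (by rw [hs, someVertex, vertexBarycenter, Finset.card_singleton]))

/-- By induction the sum below s becomes the sum of ∏ z over all proper faces of s, the empty one
included, that is ∏ (1 + z) - ∏ z. Multiplying by z at a vertex of s kills the first product, as a(1
+ a) = 0 in `ZMod 2`, and fixes the second. -/
theorem mul_chainSumBelow_someVertex (y : Config (Barycenter L)) (s : Barycenter L) :
    y (someVertex L s) * chainSumBelow (fun t => y (someVertex L t)) s =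
      ∏ v ∈ s.1, y (vertexBarycenter L v) := by
  classical
  induction s using WellFoundedLT.induction with
  | ind s ih =>
    rw [chainSumBelow_eq, Finset.sum_congr rfl fun t ht => ih t (Finset.mem_filter.1 ht).2,
      sum_barycenter_lt L s (fun t => ∏ v ∈ t, y (vertexBarycenter L v))]
    set z : V → ZMod 2 := fun v => y (vertexBarycenter L v)
    have hs0 := empty_ssubset_barycenter L s
    have hsum : ∏ v ∈ s.1, (1 + z v) =
        1 + (∏ v ∈ s.1, z v + ∑ t ∈ Finset.Ioo ∅ s.1, ∏ v ∈ t, z v) := by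
      have hp : s.1.powerset = insert ∅ (insert s.1 (Finset.Ioo ∅ s.1)) := by
        ext t
        simp only [Finset.mem_powerset, Finset.mem_insert, Finset.mem_Ioo]
        constructor
        · intro ht
          rcases t.eq_empty_or_nonempty with h | h
          · exact Or.inl h
          · rcases eq_or_ne t s.1 with h' | h'
            · exact Or.inr (Or.inl h')
            · exact Or.inr (Or.inr ⟨Finset.empty_ssubset.2 h, ht.ssubset_of_ne h'⟩)
        · rintro (h | h | h)
          · exact h ▸ hs0.1
          · exact h.le
          · exact h.2.1
      rw [Finset.prod_one_add, hp, Finset.sum_insert, Finset.sum_insert, Finset.prod_empty]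
      · simp
      · simp [hs0.ne]
    have hv := (L.isRelLowerSet_faces s.2).1.choose_spec
    have hm : y (someVertex L s) = z (L.isRelLowerSet_faces s.2).1.choose := rfl
    -- Only membership of the chosen vertex in s matters; the choices for different simplices need
    -- not be compatible.
    generalize (L.isRelLowerSet_faces s.2).1.choose = v at hv hm
    have h2 : ∀ a : ZMod 2, a * (1 + a) = 0 ∧ a * a = a ∧ -a = a := by decide
    have h3 : z v * ∏ v ∈ s.1, (1 + z v) = 0 := by
      rw [← Finset.mul_prod_erase _ _ hv, ← mul_assoc, (h2 _).1, zero_mul]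
    have h4 : z v * ∏ v ∈ s.1, z v = ∏ v ∈ s.1, z v := by
      rw [← Finset.mul_prod_erase _ _ hv, ← mul_assoc, (h2 _).2.1]
    rw [hm]
    have h5 : 1 + ∑ t ∈ Finset.Ioo ∅ s.1, ∏ v ∈ t, z v =
        ∏ v ∈ s.1, (1 + z v) - ∏ v ∈ s.1, z v := by
      rw [hsum]; ring
    rw [h5, mul_sub, h3, h4, zero_sub, (h2 _).2.2]

/-- Pulling a configuration on `L` back along a choice of vertices does not change the number of
down simplices modulo two. -/
theorem downCount_someVertex (y : Config (Barycenter L)) :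
    downCount (barycentricSubdivision L) (fun t => y (someVertex L t)) =
      downCount L (fun v => y (vertexBarycenter L v)) := by
  classical
  rw [downCount_barycentricSubdivision,
    Finset.sum_congr rfl fun t _ => mul_chainSumBelow_someVertex L y t, downCount]
  exact (Finset.sum_subtype _ (fun s => by simp)
    (fun s => ∏ v ∈ s, y (vertexBarycenter L v))).symm

end DownCount

/-! ### Sign gates -/

section SignGates

/-- The sign `(-1) ^ a`. -/
def sgn (a : ZMod 2) : ℂ := if a = 1 then -1 else 1

theorem sgn_zero : sgn 0 = 1 := if_neg (by decide)

theorem sgn_add (a b : ZMod 2) : sgn (a + b) = sgn a * sgn b := by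
  have h : ∀ a : ZMod 2, a = 0 ∨ a = 1 := by decide
  have h11 : (1 : ZMod 2) + 1 = 0 := by decide
  rcases h a with rfl | rfl <;> rcases h b with rfl | rfl <;> simp [sgn, h11]

theorem sgn_mul_self (a : ZMod 2) : sgn a * sgn a = 1 := by
  unfold sgn
  split_ifs <;> norm_num

theorem star_sgn (a : ZMod 2) : starRingEnd ℂ (sgn a) = sgn a := by
  unfold sgn
  split_ifs <;> simp

theorem sgn_sum {ι : Type*} (s : Finset ι) (f : ι → ZMod 2) :
    sgn (∑ i ∈ s, f i) = ∏ i ∈ s, sgn (f i) := by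
  classical
  induction s using Finset.induction_on with
  | empty => rw [Finset.sum_empty, Finset.prod_empty, sgn_zero]
  | insert a s ha ih => rw [Finset.sum_insert ha, Finset.prod_insert ha, sgn_add, ih]

variable {Q : Type*} [Fintype Q] [DecidableEq Q]

theorem gdsDualState_apply (K : AbstractSimplicialComplex Q) (x : Config Q) :
    gdsDualState K x = sgn (downCount K x) * plusState Q x := by
  rw [gdsDualState, disentangler, Matrix.mulVec_diagonal, downCount, sgn_sum]
  congr 1
  refine Finset.prod_congr rfl fun s _ => ?_
  rw [ckZ, Matrix.diagonal_apply_eq, sgn]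
  refine if_congr ?_ rfl rfl
  constructor
  · intro h
    exact Finset.prod_eq_one h
  · intro h q hq
    by_contra hne
    have h0 : x q = 0 := by
      generalize x q = a at hne
      revert a
      decide
    rw [Finset.prod_eq_zero hq h0] at h
    exact absurd h (by decide)

/-- The diagonal gate with entries `(-1) ^ T x`, where `T x` depends only on the qubits
in `S`. -/
noncomputable def signGate (S : Finset Q) (T : Config Q → ZMod 2)
    (hT : ∀ x y : Config Q, (∀ q ∈ S, x q = y q) → T x = T y) : Gate Q where
  support := S
  op := Matrix.diagonal fun x => sgn (T x)
  unitary := by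
    rw [Matrix.mem_unitaryGroup_iff, Matrix.star_eq_conjTranspose, Matrix.diagonal_conjTranspose,
      Matrix.diagonal_mul_diagonal, ← Matrix.diagonal_one]
    congr 1
    funext x
    rw [Pi.star_apply, ← starRingEnd_apply, star_sgn, sgn_mul_self]
  supported := by
    -- The value 0 outside S is arbitrary, since T does not see it.
    refine ⟨Matrix.diagonal fun a => sgn (T fun q => if h : q ∈ S then a ⟨q, h⟩ else 0), ?_⟩
    intro x y
    by_cases hxy : x = y
    · subst hxy
      rw [if_pos fun _ _ => rfl, Matrix.diagonal_apply_eq, Matrix.diagonal_apply_eq]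
      exact congrArg sgn (hT _ _ fun q hq => by rw [dif_pos hq])
    · rw [Matrix.diagonal_apply_ne _ hxy]
      split_ifs with h
      · refine (Matrix.diagonal_apply_ne _ fun heq => hxy (funext fun q => ?_)).symm
        by_cases hq : q ∈ S
        · exact congrFun heq ⟨q, hq⟩
        · exact h q hq
      · rfl

theorem signGate_isSymmetric (S : Finset Q) (T : Config Q → ZMod 2)
    (hT : ∀ x y : Config Q, (∀ q ∈ S, x q = y q) → T x = T y)
    (hflip : ∀ x : Config Q, T (fun q => x q + 1) = T x) : (signGate S T hT).IsSymmetric := by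
  rintro ⟨a, b⟩ ψ
  have ha : ∀ x : Config Q, T (fun q => x q - a) = T x := by
    intro x
    have h : ∀ a : ZMod 2, a = 0 ∨ a = 1 := by decide
    rcases h a with rfl | rfl
    · simp only [sub_zero]
    · rw [← hflip fun q => x q - 1]
      simp only [sub_add_cancel]
  funext x
  simp only [signGate, Matrix.mulVec_diagonal, symmetryAction, ha]
  split_ifs
  · rfl
  · rw [map_mul, star_sgn]

/-- Layers of diagonal sign gates multiply the amplitudes by the product of all the signs. -/
theorem foldl_signGates {ι : Type*} (g : ι → Gate Q) (T : ι → Config Q → ZMod 2)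
    (hg : ∀ i, (g i).op = Matrix.diagonal fun x => sgn (T i x)) (l : List ι) (ψ : State Q) :
    (l.map g).foldl (fun χ g => g.op.mulVec χ) ψ =
      fun x => (l.map fun i => sgn (T i x)).prod * ψ x := by
  induction l generalizing ψ with
  | nil => simp
  | cons i l ih =>
    rw [List.map_cons, List.foldl_cons, ih]
    funext x
    rw [hg, Matrix.mulVec_diagonal, List.map_cons, List.prod_cons]
    ring

theorem foldl_layers {ι κ : Type*} (g : ι → Gate Q) (T : ι → Config Q → ZMod 2)
    (hg : ∀ i, (g i).op = Matrix.diagonal fun x => sgn (T i x)) (m : κ → List ι)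
    (l : List κ) (ψ : State Q) :
    (l.map fun c => (m c).map g).foldl (fun φ l => l.foldl (fun χ g => g.op.mulVec χ) φ) ψ =
      fun x => (l.map fun c => ((m c).map fun i => sgn (T i x)).prod).prod * ψ x := by
  induction l generalizing ψ with
  | nil => simp
  | cons c l ih =>
    rw [List.map_cons, List.foldl_cons, ih, foldl_signGates g T hg]
    funext x
    rw [List.map_cons, List.prod_cons]
    ring

/-- A proper colouring of a finite family of sets, each of which meets at most `D` of them. -/
theorem exists_coloring {ι : Type*} [Fintype ι] [DecidableEq ι] (S : ι → Finset Q) (D : ℕ)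
    (hD : ∀ i, (Finset.univ.filter fun j => ¬ Disjoint (S i) (S j)).card ≤ D) :
    ∃ col : ι → Fin (D + 1), ∀ i j, i ≠ j → col i = col j → Disjoint (S i) (S j) := by
  suffices h : ∀ A : Finset ι, ∃ col : ι → Fin (D + 1), ∀ i ∈ A, ∀ j ∈ A,
      i ≠ j → col i = col j → Disjoint (S i) (S j) by
    obtain ⟨col, hcol⟩ := h Finset.univ
    exact ⟨col, fun i j => hcol i (Finset.mem_univ _) j (Finset.mem_univ _)⟩
  intro A
  induction A using Finset.induction_on with
  | empty => exact ⟨fun _ => 0, by simp⟩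
  | insert a A ha ih =>
    obtain ⟨col, hcol⟩ := ih
    -- Greedy choice: at most D colours are forbidden and D + 1 are available.
    obtain ⟨c, hc⟩ : ∃ c : Fin (D + 1),
        c ∉ (Finset.univ.filter fun j => ¬ Disjoint (S a) (S j)).image col := by
      by_contra! h
      have h1 := Finset.card_le_card (Finset.eq_univ_iff_forall.2 h).ge
      rw [Finset.card_univ, Fintype.card_fin] at h1
      have h2 := h1.trans (Finset.card_image_le.trans (hD a))
      omega
    have hc' : ∀ j, col j = c → Disjoint (S a) (S j) := by
      intro j hj
      by_contra hd
      exact hc (Finset.mem_image.2 ⟨j, Finset.mem_filter.2 ⟨Finset.mem_univ _, hd⟩, hj⟩)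
    refine ⟨Function.update col a c, ?_⟩
    intro i hi j hj hij hcolij
    rcases Finset.mem_insert.1 hi with rfl | hi <;> rcases Finset.mem_insert.1 hj with rfl | hj
    · exact absurd rfl hij
    · rw [Function.update_self, Function.update_of_ne hij.symm] at hcolij
      exact hc' j hcolij.symm
    · rw [Function.update_self, Function.update_of_ne hij] at hcolij
      exact (hc' i hcolij).symm
    · have hia : i ≠ a := fun h => ha (h ▸ hi)
      have hja : j ≠ a := fun h => ha (h ▸ hj)
      rw [Function.update_of_ne hia, Function.update_of_ne hja] at hcolij
      exact hcol i hi j hj hij hcolij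

/-- Sign gates whose supports each meet at most `D` of the supports can be arranged in `D + 1`
layers. -/
theorem exists_circuit_of_signGates {ι : Type*} [Fintype ι] [DecidableEq ι] (g : ι → Gate Q)
    (T : ι → Config Q → ZMod 2)
    (hg : ∀ i, (g i).op = Matrix.diagonal fun x => sgn (T i x)) (D : ℕ)
    (hD : ∀ i, (Finset.univ.filter fun j => ¬ Disjoint (g i).support (g j).support).card ≤ D) :
    ∃ c : Circuit Q, c.depth ≤ D + 1 ∧ (∀ l ∈ c.layers, ∀ h ∈ l, ∃ i, h = g i) ∧
      ∀ ψ : State Q, c.apply ψ = fun x => sgn (∑ i, T i x) * ψ x := by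
  obtain ⟨col, hcol⟩ := exists_coloring (fun i => (g i).support) D hD
  refine ⟨⟨(List.finRange (D + 1)).map fun c =>
    (Finset.univ.filter fun i => col i = c).toList.map g, ?_⟩, ?_, ?_, ?_⟩
  · intro l hl
    obtain ⟨c, -, rfl⟩ := List.mem_map.1 hl
    rw [List.pairwise_map]
    refine (Finset.nodup_toList _).pairwise_of_forall_ne fun i hi j hj hij => ?_
    rw [Finset.mem_toList, Finset.mem_filter] at hi hj
    exact hcol i j hij (hi.2.trans hj.2.symm)
  · rw [Circuit.depth, List.length_map, List.length_finRange]
  · intro l hl h hh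
    obtain ⟨c, -, rfl⟩ := List.mem_map.1 hl
    obtain ⟨i, -, rfl⟩ := List.mem_map.1 hh
    exact ⟨i, rfl⟩
  · intro ψ
    rw [Circuit.apply, foldl_layers g T hg]
    funext x
    congr 1
    rw [sgn_sum, ← Finset.prod_fiberwise Finset.univ col]
    simp only [Finset.prod_map_toList]
    rw [← List.ofFn_eq_map, List.prod_ofFn]

end SignGates

/-! ### The circuit -/

section Interpolation

variable {V : Type*} [Fintype V] [DecidableEq V] (L : AbstractSimplicialComplex V)

open Classical in
/-- The barycenters comparable to `q`. -/
noncomputable def comparables (q : Barycenter L) : Finset (Barycenter L) :=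
  Finset.univ.filter fun t => t ≤ q ∨ q ≤ t

theorem mem_comparables {q t : Barycenter L} : t ∈ comparables L q ↔ t ≤ q ∨ q ≤ t := by
  rw [comparables, Finset.mem_filter, and_iff_right (Finset.mem_univ _)]

theorem mem_comparables_comm {q t : Barycenter L} :
    t ∈ comparables L q ↔ q ∈ comparables L t := by
  rw [mem_comparables, mem_comparables, or_comm]

theorem mem_comparables_of_mem_face {s : Finset (Barycenter L)}
    (hs : s ∈ (barycentricSubdivision L).faces) {q t : Barycenter L} (hq : q ∈ s) (ht : t ∈ s) :
    t ∈ comparables L q := by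
  rw [mem_comparables]
  rcases eq_or_ne t q with rfl | hne
  · exact Or.inl le_rfl
  · exact hs.2 ht hq hne

theorem edist_le_one {q t : Barycenter L} (h : t ∈ comparables L q) :
    (oneSkeleton (barycentricSubdivision L)).edist q t ≤ 1 := by
  rw [SimpleGraph.edist_le_one_iff_adj_or_eq]
  rcases eq_or_ne q t with rfl | hne
  · exact Or.inr rfl
  · refine Or.inl ⟨hne, Finset.insert_nonempty _ _, ?_⟩
    rw [Finset.coe_pair]
    refine Set.subsingleton_singleton.isChain.insert fun b hb _ => ?_
    rw [Set.mem_singleton_iff.1 hb]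
    exact ((mem_comparables L).1 h).symm

/-- The barycenters at distance at most two from `q`. -/
noncomputable def secondComparables (q : Barycenter L) : Finset (Barycenter L) :=
  (comparables L q).biUnion (comparables L)

theorem edist_le_four {q p p' : Barycenter L} (hp : p ∈ secondComparables L q)
    (hp' : p' ∈ secondComparables L q) :
    (oneSkeleton (barycentricSubdivision L)).edist p p' ≤ 4 := by
  have h2 : ∀ p ∈ secondComparables L q,
      (oneSkeleton (barycentricSubdivision L)).edist q p ≤ 2 := by
    intro p hp
    obtain ⟨t, ht, htp⟩ := Finset.mem_biUnion.1 hp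
    refine SimpleGraph.edist_triangle.trans ((add_le_add (edist_le_one L ht)
      (edist_le_one L htp)).trans ?_)
    norm_num
  refine (SimpleGraph.edist_triangle (v := q)).trans ?_
  rw [SimpleGraph.edist_comm]
  refine (add_le_add (h2 p hp) (h2 p' hp')).trans ?_
  norm_num

/-! ### Bounds on the size and overlap of the supports. -/

theorem card_le_of_vertexBound {R : ℕ} (hR : VertexBound L R) (q : Barycenter L) :
    q.1.card ≤ R := by
  obtain ⟨v, hv⟩ := (L.isRelLowerSet_faces q.2).1
  refine le_trans ?_ (hR v)
  rw [← Set.ncard_coe_finset]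
  -- The vertices w of q inject into the simplices containing v; w = v gives the vertex {v} itself.
  refine Set.ncard_le_ncard_of_injOn (fun w => ({v, w} : Finset V)) ?_ ?_ (Set.toFinite _)
  · intro w hw
    refine ⟨(L.isRelLowerSet_faces q.2).2 ?_ (Finset.insert_nonempty _ _),
      Finset.mem_insert_self _ _⟩
    exact Finset.insert_subset hv (Finset.singleton_subset_iff.2 hw)
  · intro w _ w' _ h
    have h : ({v, w} : Finset V) = {v, w'} := h
    have h1 : w ∈ ({v, w'} : Finset V) := h ▸ by simp
    have h2 : w' ∈ ({v, w} : Finset V) := h ▸ by simp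
    simp only [Finset.mem_insert, Finset.mem_singleton] at h1 h2
    grind

/-- Comparable simplices share a vertex: q has at most R vertices, each in at most R simplices. -/
theorem card_comparables_le {R : ℕ} (hR : VertexBound L R) (q : Barycenter L) :
    (comparables L q).card ≤ R * R := by
  classical
  have hsub : comparables L q ⊆
      q.1.biUnion fun v => Finset.univ.filter fun t : Barycenter L => v ∈ t.1 := by
    intro t ht
    rw [Finset.mem_biUnion]
    rcases (mem_comparables L).1 ht with h | h
    · obtain ⟨v, hv⟩ := (L.isRelLowerSet_faces t.2).1
      exact ⟨v, h hv, Finset.mem_filter.2 ⟨Finset.mem_univ _, hv⟩⟩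
    · obtain ⟨v, hv⟩ := (L.isRelLowerSet_faces q.2).1
      exact ⟨v, hv, Finset.mem_filter.2 ⟨Finset.mem_univ _, h hv⟩⟩
  refine (Finset.card_le_card hsub).trans ((Finset.card_biUnion_le_card_mul _ _ R ?_).trans
    (Nat.mul_le_mul_right _ (card_le_of_vertexBound L hR q)))
  intro v _
  refine le_trans ?_ (hR v)
  rw [← Set.ncard_coe_finset]
  refine Set.ncard_le_ncard_of_injOn (fun t : Barycenter L => t.1) ?_
    Subtype.val_injective.injOn (Set.toFinite _)
  intro t ht
  exact ⟨t.2, (Finset.mem_filter.1 ht).2⟩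

theorem card_secondComparables_le {R : ℕ} (hR : VertexBound L R) (q : Barycenter L) :
    (secondComparables L q).card ≤ R * R * (R * R) :=
  (Finset.card_biUnion_le_card_mul _ _ _ fun t _ => card_comparables_le L hR t).trans
    (Nat.mul_le_mul_right _ (card_comparables_le L hR q))

open Classical in
theorem card_secondComparables_meet_le {R : ℕ} (hR : VertexBound L R) (q : Barycenter L) :
    (Finset.univ.filter fun p =>
      ¬ Disjoint (secondComparables L q) (secondComparables L p)).card ≤
        R * R * (R * R) * (R * R * (R * R)) := by
  have hsub : (Finset.univ.filter fun p =>
      ¬ Disjoint (secondComparables L q) (secondComparables L p)) ⊆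
        (secondComparables L q).biUnion (secondComparables L) := by
    intro p hp
    obtain ⟨a, ha, hap⟩ := Finset.not_disjoint_iff.1 (Finset.mem_filter.1 hp).2
    obtain ⟨t, ht, hta⟩ := Finset.mem_biUnion.1 hap
    exact Finset.mem_biUnion.2 ⟨a, ha, Finset.mem_biUnion.2
      ⟨t, (mem_comparables_comm L).1 hta, (mem_comparables_comm L).1 ht⟩⟩
  exact (Finset.card_le_card hsub).trans ((Finset.card_biUnion_le_card_mul _ _ _
    fun t _ => card_secondComparables_le L hR t).trans
      (Nat.mul_le_mul_right _ (card_secondComparables_le L hR q)))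

/-- The configuration in which every spin of index less than `k` has been replaced by the spin at
the chosen vertex of its simplex. -/
noncomputable def interpolation (idx : Barycenter L → ℕ) (k : ℕ) (y : Config (Barycenter L)) :
    Config (Barycenter L) :=
  fun t => if idx t < k then y (someVertex L t) else y t

theorem interpolation_congr (idx : Barycenter L → ℕ) (k : ℕ) {q : Barycenter L}
    {x y : Config (Barycenter L)} (h : ∀ p ∈ secondComparables L q, x p = y p)
    {t : Barycenter L} (ht : t ∈ comparables L q) :
    interpolation L idx k x t = interpolation L idx k y t := by
  have h1 : x t = y t := h t (Finset.mem_biUnion.2 ⟨t, ht, (mem_comparables L).2 (Or.inl le_rfl)⟩)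
  have h2 : x (someVertex L t) = y (someVertex L t) := h _ (Finset.mem_biUnion.2
    ⟨t, ht, (mem_comparables L).2 (Or.inl (someVertex_le L t))⟩)
  rw [interpolation, interpolation, h1, h2]

theorem interpolation_of_card_eq_one (idx : Barycenter L → ℕ) (k : ℕ)
    (y : Config (Barycenter L)) {t : Barycenter L} (ht : t.1.card = 1) :
    interpolation L idx k y t = y t := by
  rw [interpolation, someVertex_of_card_eq_one L ht, ite_self]

theorem interpolation_add_one (idx : Barycenter L → ℕ) (k : ℕ) (y : Config (Barycenter L)) :
    interpolation L idx k (fun t => y t + 1) = fun t => interpolation L idx k y t + 1 := by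
  funext t
  simp only [interpolation]
  split_ifs <;> rfl

theorem interpolation_succ {idx : Barycenter L → ℕ} {k : ℕ} (y : Config (Barycenter L))
    {t : Barycenter L} (ht : idx t ≠ k) :
    interpolation L idx k y t = interpolation L idx (k + 1) y t := by
  rw [interpolation, interpolation]
  exact if_congr (by omega) rfl rfl

/-- The change of the number of down simplices in one step of the interpolation. -/
noncomputable def interpolationStep (idx : Barycenter L → ℕ) (k : ℕ)
    (y : Config (Barycenter L)) : ZMod 2 :=
  downCount (barycentricSubdivision L) (interpolation L idx k y) -
    downCount (barycentricSubdivision L) (interpolation L idx (k + 1) y)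

/-- Injectivity of the index makes q the only spin that changes, so only chains through q count.
Their elements t are comparable to q, and the interpolated spin at t reads t or its chosen vertex,
which is comparable to t; hence two rounds of comparability. -/
theorem interpolationStep_congr {idx : Barycenter L → ℕ} (hidx : Function.Injective idx)
    (q : Barycenter L) (x y : Config (Barycenter L))
    (h : ∀ p ∈ secondComparables L q, x p = y p) :
    interpolationStep L idx (idx q) x = interpolationStep L idx (idx q) y :=
  downCount_sub_congr _ q
    (fun _ hp => interpolation_succ L x (hidx.ne hp))
    (fun _ hp => interpolation_succ L y (hidx.ne hp))
    (fun _ hs hq _ hp => interpolation_congr L idx _ h (mem_comparables_of_mem_face L hs hq hp))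
    (fun _ hs hq _ hp => interpolation_congr L idx _ h (mem_comparables_of_mem_face L hs hq hp))

/-- Interpolation commutes with the flip, and consecutive interpolations agree on the vertices of L,
so the flip changes both down counts by the same amount. -/
theorem interpolationStep_add_one
    (hL : ∀ s ∈ L.faces, 2 ≤ s.card → Even (eulerChar (link L s)))
    (idx : Barycenter L → ℕ) (k : ℕ) (y : Config (Barycenter L)) :
    interpolationStep L idx k (fun t => y t + 1) = interpolationStep L idx k y := by
  rw [interpolationStep, interpolationStep, interpolation_add_one, interpolation_add_one]
  have h := downCount_add_one_sub_congr L hL (x := interpolation L idx k y)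
    (y := interpolation L idx (k + 1) y) fun s hs => by
      rw [interpolation_of_card_eq_one L idx k y hs, interpolation_of_card_eq_one L idx _ y hs]
  linear_combination h

theorem sum_interpolationStep (idx : Barycenter L → ℕ) (n : ℕ) (hn : ∀ t, idx t < n)
    (y : Config (Barycenter L)) :
    ∑ k ∈ Finset.range n, interpolationStep L idx k y =
      downCount (barycentricSubdivision L) y - downCount L (fun v => y (vertexBarycenter L v)) := by
  have h0 : interpolation L idx 0 y = y := by
    funext t
    exact if_neg (Nat.not_lt_zero _)
  have h1 : interpolation L idx n y = fun t => y (someVertex L t) := by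
    funext t
    exact if_pos (hn t)
  simp only [interpolationStep]
  rw [Finset.sum_range_sub', h0, h1, downCount_someVertex]

theorem plusState_split (x : Config (Barycenter L)) :
    plusState V (fun v => x (vertexSplit L (Sum.inl v))) *
      plusState (NewVertex L) (fun b => x (vertexSplit L (Sum.inr b))) =
        plusState (Barycenter L) x := by
  rw [plusState, plusState, plusState, ← (vertexSplit L).prod_comp, Fintype.prod_sum_type]

end Interpolation

end GDSDual

/-! ### Assembly of the symmetric circuit. -/

theorem mainTheorem7 :
    ∃ (r : ℕ) (f : ℕ → ℕ),
      ∀ (V : Type*) [Fintype V] [DecidableEq V] (L : AbstractSimplicialComplex V) (d R : ℕ),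
        GDSDual.HasDimension L d →
        GDSDual.VertexBound L R →
        (∀ s ∈ L.faces, s.card = d →
          ∃ a b : V, a ≠ b ∧ (GDSDual.link L s).faces = {{a}, {b}}) →
        (∀ s ∈ L.faces, 2 ≤ s.card → Even (GDSDual.eulerChar (GDSDual.link L s))) →
        ∃ c : GDSDual.Circuit (GDSDual.Barycenter L),
          c.IsLocallySymmetric ∧
          c.HasRange (GDSDual.barycentricSubdivision L) r ∧
          c.depth ≤ f R ∧
          c.apply (GDSDual.tensorState (GDSDual.vertexSplit L) (GDSDual.gdsDualState L)
              (GDSDual.plusState (GDSDual.NewVertex L))) =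
            GDSDual.gdsDualState (GDSDual.barycentricSubdivision L) := by
  -- Supports have radius 2, hence diameter at most 4. Each meets at most R ^ 8 supports, itself
  -- included, and the colouring needs one more colour than that.
  refine ⟨4, fun R => R * R * (R * R) * (R * R * (R * R)) + 1, ?_⟩
  intro V _ _ L d R _ hR _ hL
  -- Any ordering of the barycenters will do; it governs the replacements, not the layers.
  let e := Fintype.equivFin (GDSDual.Barycenter L)
  have hidx : Function.Injective fun t => (e t : ℕ) := fun t t' h => e.injective (Fin.ext h)
  obtain ⟨c, hdepth, hgates, happly⟩ := GDSDual.exists_circuit_of_signGates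
    (fun q => GDSDual.signGate (GDSDual.secondComparables L q) _
      (GDSDual.interpolationStep_congr L hidx q)) _ (fun _ => rfl) _
    (fun q => by convert GDSDual.card_secondComparables_meet_le L hR q <;> rfl)
  refine ⟨c, ?_, ?_, hdepth, ?_⟩
  · intro l hl g hg
    obtain ⟨q, rfl⟩ := hgates l hl g hg
    exact GDSDual.signGate_isSymmetric _ _ _ (GDSDual.interpolationStep_add_one L hL _ _)
  · intro l hl g hg p hp p' hp'
    obtain ⟨q, rfl⟩ := hgates l hl g hg
    exact GDSDual.edist_le_four L hp hp'
  · rw [happly]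
    funext x
    have hsum : ∑ q, GDSDual.interpolationStep L (fun t => (e t : ℕ)) (e q) x =
        GDSDual.downCount (GDSDual.barycentricSubdivision L) x -
          GDSDual.downCount L (fun v => x (GDSDual.vertexBarycenter L v)) := by
      rw [← GDSDual.sum_interpolationStep L (fun t => (e t : ℕ)) _ (fun t => (e t).isLt) x,
        e.sum_comp fun k => GDSDual.interpolationStep L (fun t => (e t : ℕ)) k x,
        Fin.sum_univ_eq_sum_range fun k => GDSDual.interpolationStep L (fun t => (e t : ℕ)) k x]
    rw [hsum, GDSDual.tensorState, GDSDual.gdsDualState_apply, mul_assoc,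
      GDSDual.plusState_split, GDSDual.gdsDualState_apply, ← mul_assoc, ← GDSDual.sgn_add]
    congr 2
    exact sub_add_cancel _ _
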